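/- Let $V=\langle f_1,f_2,f_3\rangle$ be a three-dimensional complex vector space, let $L_2=\operatorname{Hom}(\bigwedge^2V,V)$, and let $\psi^{ij}_k\in L_2$ ($i<j$) send $f_i\wedge f_j$ to $f_k$ and the other basis elements of $\bigwedge^2V$ to $0$. A codifferential is an element of $L_2$ (or of $L_2\otimes A$, for a commutative $\mathbb C$-algebra $A$) satisfying the Jacobi identity. Two codifferentials $d,d'$ are equivalent, $d\sim d'$, if $g^*(d)=g^{-1}\circ d\circ(g\wedge g)=d'$ for some invertible linear $g$. Put $$d_2=\psi^{13}_1+\psi^{23}_2,\qquad d(\lambda:\mu)=\lambda\,\psi^{13}_1+\psi^{23}_1+\mu\,\psi^{23}_2 ,$$ so that $d_2$ is the Lie algebra $\mathfrak r_{3,1}(\mathbb C)$, and put $$d^\infty(t)=\psi^{13}_1(1+t^1)+\psi^{23}_2+\psi^{13}_2t^2+\psi^{23}_1t^3 .$$ Deformations with base $A$ are taken over local $\mathbb C$-algebras $A$ with an augmentation $\varepsilon:A\to\mathbb C$, whose kernel is the maximal ideal $\mathfrak m$. $A$ is formal if $A=\varprojlim A/\mathfrak m^k$, and infinitesimal if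 $\mathfrak m^2=0$. A deformation of $d$ with base $A$ is a codifferential $d_A\in L_2\otimes A$ with $\varepsilon_*(d_A)=d$. Two deformations with base $A$ are infinitesimally equivalent if $g^*$ carries the first to the second for an $A$-linear automorphism $g$ of $V\otimes A$ with $\varepsilon_*(g)=1_V$. An infinitesimal deformation $d_A$ (one whose base is infinitesimal) is universal if for every infinitesimal deformation $d_B$ of $d$ there is a unique homomorphism $h:A\to B$ with $h_*(d_A)$ infinitesimally equivalent to $d_B$. A formal deformation $d_A$ (one whose base is formal) is miniversal if for every formal deformation $d_B$ of $d$ such an $h$ exists, and $h$ is unique whenever $B$ is infinitesimal. Then: 1. The cochains $\psi^{13}_1,\psi^{13}_2,\psi^{23}_1$ are cocycles whose classes form a basis of $H^2(d_2)$, and $d^\infty(t)$ over $\mathbb C[t^1,t^2,t^3]/(t^1,t^2,t^3)^2$ is a universal infinitesimal deformation of $d_2$. 2. The same formula $d^\infty(t)$ over $\mathbb C[[t^1,t^2,t^3]]$ (no relations on the base) is a miniversal deformation of $d_2$. 3. For complex values $t^1=t^2=0$, $t^3\neq0$ one has $g^*(d^\infty(t))=d(1:1)$ with $g=\operatorname{Diag}(t^3,1,1)$.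 Moreover $d_2\not\sim d(1:1)$, so the curve $t^1=t^2=0$ is a jump deformation from $d_2$ to $d(1:1)$: an analytic one-parameter family of codifferentials that is $d_2$ at $t^3=0$ and is equivalent, for all small $t^3\ne0$, to the fixed codifferential $d(1:1)\not\sim d_2$. 4. For all other complex values $(t^1,t^2,t^3)$, that is, $(t^1,t^2)\neq(0,0)$, one has $d^\infty(t)\sim d(\alpha:\beta)$, where $$\{\alpha,\beta\}=\frac{2+t^1\pm\sqrt{(t^1)^2+4t^2t^3}}2 ,$$ as long as $(\alpha,\beta)\neq(0,0)$; in particular this holds whenever $t^1\neq-2$. -/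

import Mathlib

universe u v

noncomputable section

namespace LieDef

/-! ### Coderivations of `⋀ V`, `V = ⟨f₁, f₂, f₃⟩`, with coefficients in a commutative ring

Indices start at `0`, so `f₁, f₂, f₃` are `f 0, f 1, f 2`. -/

/-- `V ⊗ A`, with its standard basis `f 0, f 1, f 2`. -/
abbrev V (A : Type u) : Type u := Fin 3 → A

/-- The basis vectors of `V ⊗ A`. -/
def f {A : Type u} [CommRing A] (i : Fin 3) : V A := Pi.single i 1

/-- `L₂ ⊗ A = Hom(⋀² V, V) ⊗ A`: alternating `A`-bilinear maps on `V ⊗ A`. -/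
abbrev L2 (A : Type u) [CommRing A] : Type u := V A [⋀^Fin 2]→ₗ[A] V A

theorem L2.add_left {A : Type u} [CommRing A] (d : L2 A) (x y z : V A) :
    d ![x + y, z] = d ![x, z] + d ![y, z] := by
  have e : ∀ w : V A, Function.update ![x, z] 0 w = ![w, z] := fun w => by
    ext i; fin_cases i <;> rfl
  have h := d.map_update_add ![x, z] 0 x y
  rwa [e, e, e] at h

theorem L2.add_right {A : Type u} [CommRing A] (d : L2 A) (x y z : V A) :
    d ![z, x + y] = d ![z, x] + d ![z, y] := by
  have e : ∀ w : V A, Function.update ![z, x] 1 w = ![z, w] := fun w => by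
    ext i; fin_cases i <;> rfl
  have h := d.map_update_add ![z, x] 1 x y
  rwa [e, e, e] at h

theorem L2.smul_left {A : Type u} [CommRing A] (d : L2 A) (r : A) (x z : V A) :
    d ![r • x, z] = r • d ![x, z] := by
  have e : ∀ w : V A, Function.update ![x, z] 0 w = ![w, z] := fun w => by
    ext i; fin_cases i <;> rfl
  have h := d.map_update_smul ![x, z] 0 r x
  rwa [e, e] at h

theorem L2.smul_right {A : Type u} [CommRing A] (d : L2 A) (r : A) (x z : V A) :
    d ![z, r • x] = r • d ![z, x] := by
  have e : ∀ w : V A, Function.update ![z, x] 1 w = ![z, w] := fun w => by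
    ext i; fin_cases i <;> rfl
  have h := d.map_update_smul ![z, x] 1 r x
  rwa [e, e] at h

/-- The basis element `ψ_k^{ij}` of `L₂`: it sends `f_i ∧ f_j` to `f_k`, and the other
basis elements of `⋀² V` to `0`. -/
def psi {A : Type u} [CommRing A] (i j k : Fin 3) : L2 A where
  toFun v := (v 0 i * v 1 j - v 0 j * v 1 i) • f k
  map_update_add' v a x y := by
    fin_cases a <;> simp [← add_smul] <;> ring_nf
  map_update_smul' v a c x := by
    fin_cases a <;> simp [smul_smul] <;> ring_nf
  map_eq_zero_of_eq' v a b hab hne := by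
    have h : v 0 = v 1 := by
      fin_cases a <;> fin_cases b <;> simp_all
    simp [h, mul_comm]

/-- The composition `φ ψ ∈ L₃` of two elements of `L₂`, evaluated on `a ∧ b ∧ c`. -/
def comp {A : Type u} [CommRing A] (φ ψ : L2 A) (a b c : V A) : V A :=
  φ ![ψ ![a, b], c] - φ ![ψ ![a, c], b] + φ ![ψ ![b, c], a]

/-- `d ∈ L₂ ⊗ A` is a codifferential if `d² = 0`, that is, if it satisfies the Jacobi
relation: it is a Lie algebra structure on `V ⊗ A`. -/
def IsCodifferential {A : Type u} [CommRing A] (d : L2 A) : Prop :=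
  ∀ a b c : V A, comp d d a b c = 0

/-- `g^*(d) = g⁻¹ ∘ d ∘ (g ∧ g)`. -/
def pullback {A : Type u} [CommRing A] (g : V A ≃ₗ[A] V A) (d : L2 A) : L2 A :=
  (g.symm : V A →ₗ[A] V A).compAlternatingMap (d.compLinearMap (g : V A →ₗ[A] V A))

/-- Equivalence of codifferentials (isomorphism of Lie algebra structures). -/
def Equivalent {A : Type u} [CommRing A] (d d' : L2 A) : Prop :=
  ∃ g : V A ≃ₗ[A] V A, pullback g d = d'

/-- `h_* : L₂ ⊗ A → L₂ ⊗ B`, applying `h` to the coefficients in the basis `ψ_k^{ij}`,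
`i < j`. -/
def push {A : Type u} {B : Type v} [CommRing A] [CommRing B] (h : A →+* B) (d : L2 A) : L2 B :=
  ∑ k : Fin 3,
    (h (d ![f 0, f 1] k) • psi 0 1 k + h (d ![f 0, f 2] k) • psi 0 2 k
      + h (d ![f 1, f 2] k) • psi 1 2 k)

/-! ### The second cohomology group -/

/-- 2-cocycles: `ψ ∈ L₂` with `D ψ = [d, ψ] = d ψ + ψ d = 0`. -/
def Z2 (d : L2 ℂ) : Submodule ℂ (L2 ℂ) where
  carrier := {ψ | ∀ a b c, comp d ψ a b c + comp ψ d a b c = 0}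
  zero_mem' a b c := by
    have h : ∀ x : V ℂ, d ![0, x] = 0 := fun x => d.map_coord_zero 0 rfl
    simp [comp, h]
  add_mem' {ψ χ} hψ hχ a b c := by
    have h := L2.add_left d
    have e := congrArg₂ (· + ·) (hψ a b c) (hχ a b c)
    simp only [comp, add_zero] at e
    simp only [comp, AlternatingMap.add_apply, h]
    rw [← e]
    abel
  smul_mem' r ψ hψ a b c := by
    have h := L2.smul_left d
    have e := congrArg (r • ·) (hψ a b c)
    simp only [comp, smul_zero] at e
    simp only [comp, AlternatingMap.smul_apply, h]
    rw [← e]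
    module

/-- 2-coboundaries: `D φ = [d, φ] = d φ - φ d` for `φ ∈ L₁ = Hom(V, V)`. -/
def B2 (d : L2 ℂ) : Submodule ℂ (L2 ℂ) where
  carrier := {ψ | ∃ φ : V ℂ →ₗ[ℂ] V ℂ, ∀ a b,
    ψ ![a, b] = d ![φ a, b] + d ![a, φ b] - φ (d ![a, b])}
  zero_mem' := ⟨0, fun a b => by
    have h : ∀ x : V ℂ, d ![0, x] = 0 := fun x => d.map_coord_zero 0 rfl
    have h' : ∀ x : V ℂ, d ![x, 0] = 0 := fun x => d.map_coord_zero 1 rfl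
    simp [h, h']⟩
  add_mem' := by
    rintro ψ χ ⟨φ, hφ⟩ ⟨θ, hθ⟩
    refine ⟨φ + θ, fun a b => ?_⟩
    have h := L2.add_left d
    have h' := L2.add_right d
    simp only [AlternatingMap.add_apply, hφ, hθ, LinearMap.add_apply, h, h']
    abel
  smul_mem' := by
    rintro r ψ ⟨φ, hφ⟩
    refine ⟨r • φ, fun a b => ?_⟩
    have h := L2.smul_left d
    have h' := L2.smul_right d
    simp only [AlternatingMap.smul_apply, hφ, LinearMap.smul_apply, h, h']
    module

/-- `H²(d) = Z² / B²`, as the image of `Z²` in `L₂ / B²`. -/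
abbrev H2 (d : L2 ℂ) : Submodule ℂ (L2 ℂ ⧸ B2 d) := (Z2 d).map (B2 d).mkQ

/-- `δ` is a prebasis of `H²(d)`: a family of cocycles whose classes form a basis. -/
def IsPrebasisH2 {ι : Type} (d : L2 ℂ) (δ : ι → L2 ℂ) : Prop :=
  (∀ i, δ i ∈ Z2 d) ∧
    ∃ b : Module.Basis ι ℂ (H2 d), ∀ i, (b i : L2 ℂ ⧸ B2 d) = (B2 d).mkQ (δ i)

/-! ### Deformations over local and formal bases

An augmented `ℂ`-algebra is a `ℂ`-algebra `A` with `ε : A →ₐ[ℂ] ℂ`; when `A` is local, `ker ε`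
is its maximal ideal `𝔪`, and every algebra homomorphism between local augmented algebras
commutes with the augmentations. -/

/-- A formal algebra: local, and complete and separated for the `𝔪`-adic topology, that is,
`A = lim A / 𝔪ᵏ`. -/
structure IsFormalAlgebra {A : Type u} [CommRing A] [Algebra ℂ A] (ε : A →ₐ[ℂ] ℂ) : Prop where
  isLocal : IsLocalRing A
  complete : IsAdicComplete (RingHom.ker ε) A

/-- An infinitesimal algebra: local, with `𝔪² = 0`. -/
structure IsInfinitesimalAlgebra {A : Type u} [CommRing A] [Algebra ℂ A] (ε : A →ₐ[ℂ] ℂ) :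
    Prop where
  isLocal : IsLocalRing A
  sq_eq_bot : RingHom.ker ε ^ 2 = ⊥

/-- `dA` is a deformation of `d` with base `A`: a codifferential with `ε_*(dA) = d`. As `V` is
finite dimensional, `L₂ ⊗̂ A = L₂ ⊗ A` for a formal algebra `A`. -/
structure IsDeformation {A : Type u} [CommRing A] [Algebra ℂ A] (ε : A →ₐ[ℂ] ℂ)
    (d : L2 ℂ) (dA : L2 A) : Prop where
  codifferential : IsCodifferential dA
  augmentation : push (ε : A →+* ℂ) dA = d

/-- Infinitesimal equivalence: `g^*(dA) = dA'` for an automorphism `g` of `V ⊗ A` with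
`ε_*(g) = 1_V`. -/
def InfEquivalent {A : Type u} [CommRing A] [Algebra ℂ A] (ε : A →ₐ[ℂ] ℂ) (dA dA' : L2 A) :
    Prop :=
  ∃ g : V A ≃ₗ[A] V A, (∀ (x : V A) (i : Fin 3), ε (g x i) = ε (x i)) ∧ pullback g dA = dA'

/-- `dA` is a universal infinitesimal deformation of `d`. The universe `v` is that of the test
algebras `B`. -/
structure IsUniversalInfinitesimal {A : Type u} [CommRing A] [Algebra ℂ A] (ε : A →ₐ[ℂ] ℂ)
    (d : L2 ℂ) (dA : L2 A) : Prop where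
  base : IsInfinitesimalAlgebra ε
  deformation : IsDeformation ε d dA
  universal : ∀ (B : Type v) [CommRing B] [Algebra ℂ B] (εB : B →ₐ[ℂ] ℂ) (dB : L2 B),
    IsInfinitesimalAlgebra εB → IsDeformation εB d dB →
      ∃! h : A →ₐ[ℂ] B, InfEquivalent εB (push (h : A →+* B) dA) dB

/-- `dA` is a versal (formal) deformation of `d`. -/
structure IsVersal {A : Type u} [CommRing A] [Algebra ℂ A] (ε : A →ₐ[ℂ] ℂ)
    (d : L2 ℂ) (dA : L2 A) : Prop where
  base : IsFormalAlgebra ε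
  deformation : IsDeformation ε d dA
  versal : ∀ (B : Type v) [CommRing B] [Algebra ℂ B] (εB : B →ₐ[ℂ] ℂ) (dB : L2 B),
    IsFormalAlgebra εB → IsDeformation εB d dB →
      ∃ h : A →ₐ[ℂ] B, InfEquivalent εB (push (h : A →+* B) dA) dB

/-- `dA` is a miniversal deformation of `d`: versal, and the homomorphism to an infinitesimal
base is unique. -/
structure IsMiniversal {A : Type u} [CommRing A] [Algebra ℂ A] (ε : A →ₐ[ℂ] ℂ)
    (d : L2 ℂ) (dA : L2 A) : Prop extends IsVersal.{u, v} ε d dA where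
  unique : ∀ (B : Type v) [CommRing B] [Algebra ℂ B] (εB : B →ₐ[ℂ] ℂ) (dB : L2 B),
    IsInfinitesimalAlgebra εB → IsDeformation εB d dB →
      ∀ h h' : A →ₐ[ℂ] B, InfEquivalent εB (push (h : A →+* B) dA) dB →
        InfEquivalent εB (push (h' : A →+* B) dA) dB → h = h'

/-- The one-parameter family `D` of Lie algebra structures, analytic at `0`, is a jump
deformation from `d` to `d'`: `D 0 = d`, and `D s ∼ d'` for all small `s ≠ 0`, where `d'` is
not equivalent to `d`. -/
structure IsJumpDeformation (D : ℂ → L2 ℂ) (d d' : L2 ℂ) : Prop where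
  codifferential : ∀ s, IsCodifferential (D s)
  analytic : ∀ (x : Fin 2 → V ℂ) (i : Fin 3), AnalyticAt ℂ (fun s => D s x i) 0
  zero : D 0 = d
  equivalent : ∀ᶠ s in nhdsWithin (0 : ℂ) {0}ᶜ, Equivalent (D s) d'
  not_equivalent : ¬ Equivalent d d'

/-! ### The objects of the theorem -/

/-- The base `ℂ[[t¹, t², t³]]`. -/
abbrev PS : Type := MvPowerSeries (Fin 3) ℂ

/-- The augmentation of `ℂ[[t¹, t², t³]]`: the constant coefficient. -/
def augPS : PS →ₐ[ℂ] ℂ :=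
  { (MvPowerSeries.constantCoeff : PS →+* ℂ) with
    commutes' := fun r => by simp [MvPowerSeries.algebraMap_apply] }

/-- The base `ℂ[t¹, t², t³] / (t¹, t², t³)²`. -/
abbrev Inf1 : Type :=
  MvPolynomial (Fin 3) ℂ ⧸
    (Ideal.span (Set.range (MvPolynomial.X : Fin 3 → MvPolynomial (Fin 3) ℂ)) ^ 2)

/-- The augmentation of `ℂ[t¹, t², t³] / (t¹, t², t³)²`: evaluation at `0`. -/
def augInf1 : Inf1 →ₐ[ℂ] ℂ :=
  Ideal.Quotient.liftₐ _ (MvPolynomial.aeval (0 : Fin 3 → ℂ)) (by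
    intro a ha
    have h1 : Ideal.span (Set.range (MvPolynomial.X : Fin 3 → MvPolynomial (Fin 3) ℂ)) ≤
        RingHom.ker (MvPolynomial.aeval (0 : Fin 3 → ℂ)) := by
      rw [Ideal.span_le]
      rintro _ ⟨i, rfl⟩
      simp
    exact h1 (Ideal.pow_le_self two_ne_zero ha))

/-- The codifferential `d₂ = ψ_1^{13} + ψ_2^{23}`, representing `𝔯_{3,1}(ℂ)`. -/
def d2 {A : Type u} [CommRing A] : L2 A := psi 0 2 0 + psi 1 2 1

/-- The codifferential `d(l : m) = l ψ_1^{13} + ψ_1^{23} + m ψ_2^{23}`. -/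
def dFam (l m : ℂ) : L2 ℂ := l • psi 0 2 0 + psi 1 2 0 + m • psi 1 2 1

/-- The cochains `δ₁ = ψ_1^{13}`, `δ₂ = ψ_2^{13}`, `δ₃ = ψ_1^{23}`. -/
def delta {A : Type u} [CommRing A] : Fin 3 → L2 A := ![psi 0 2 0, psi 0 2 1, psi 1 2 0]

/-- `d₂ + t¹ δ₁ + t² δ₂ + t³ δ₃ = ψ_1^{13} (1 + t¹) + ψ_2^{23} + ψ_2^{13} t² + ψ_1^{23} t³`,
for elements `t¹, t², t³` (that is, `t 0, t 1, t 2`) of a ring `A`. -/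
def dDef {A : Type u} [CommRing A] (t : Fin 3 → A) : L2 A := d2 + ∑ i, t i • delta i

end LieDef

end

open LieDef

/-!
Let `dB` be a deformation of `d₂` over a local augmented algebra `B`. Its trace form
`θ x = tr (ad x)` vanishes on brackets, and `θ (f 2)` reduces to `-2`, so it is a unit. Hence
`ker θ` is an ideal, free of rank two, that contains all brackets; it is abelian, since on it the
traces `θ` of the two basis vectors are, up to sign, the coefficients of their bracket. So `dB` is
the semidirect product given by the action of the third basis vector on `ker θ`, and scaling that
vector makes the lower right entry of the action equal to `1`, which is the shape of the family
`dDef t`. All base changes reduce to the identity. Thus every deformation over any local base is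
infinitesimally equivalent to some `dDef t` with `t` in the maximal ideal
(`exists_infEquivalent_dDef`): no obstruction theory and no order-by-order lifting is needed, and
there are no relations on the base. In coordinates, all this is one Jacobi identity on the basis
vectors (`IsCodifferential.jacobi_basis`).

If the square of the maximal ideal is zero, the parameters `t` are recovered from the structure
constants of any deformation equivalent to `dDef t` (`parameters_of_infEquivalent`). Both
universal properties follow, since homomorphisms from `ℂ[t¹, t², t³] / (t¹, t², t³)²` to an
infinitesimal base and from `ℂ[[t¹, t², t³]]` to a formal base can be prescribed on the variables
within the maximal ideal (`exists_algHom_Inf1`, `exists_algHom_PS`), and into an infinitesimal base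
they are determined there (`algHom_Inf1_ext`, `algHom_PS_ext`).

Over `ℂ`, `dDef t` is the semidirect product given by the matrix `(1 + t 0, t 2; t 1, 1)`, and
`dFam α β` the one given by `(α, 1; 0, β)`; a nonscalar matrix with eigenvalues `α, β` is conjugate
to the latter (`equivalent_dDef_dFam`).
-/

namespace LieDef

/-! ### Cochains in coordinates -/

section Coordinates

variable {A : Type u} [CommRing A]

/-- The trilinear and bilinear identities below all reduce to this expansion of an alternating
map in its values on the pairs `f i ∧ f j`, `i < j`. -/
theorem L2.apply_eq (d : L2 A) (x y : V A) :
    d ![x, y] = (x 0 * y 1 - x 1 * y 0) • d ![f 0, f 1] + (x 0 * y 2 - x 2 * y 0) • d ![f 0, f 2]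
      + (x 1 * y 2 - x 2 * y 1) • d ![f 1, f 2] := by
  have ex : ∀ z : V A, z = z 0 • f 0 + z 1 • f 1 + z 2 • f 2 := fun z => by
    funext i; fin_cases i <;> simp [f]
  have self : ∀ z : V A, d ![z, z] = 0 := fun z =>
    d.map_eq_zero_of_eq ![z, z] (i := 0) (j := 1) rfl (by decide)
  have swap : ∀ z w : V A, d ![w, z] = -d ![z, w] := fun z w => by
    have h := self (z + w)
    rw [L2.add_left, L2.add_right, L2.add_right, self, self, zero_add, add_zero] at h
    exact eq_neg_of_add_eq_zero_right h
  conv_lhs => rw [ex x, ex y]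
  simp only [L2.add_left, L2.add_right, L2.smul_left, L2.smul_right, self,
    swap (f 0) (f 1), swap (f 0) (f 2), swap (f 1) (f 2)]
  module

theorem L2.ext_basis {d d' : L2 A} (h01 : d ![f 0, f 1] = d' ![f 0, f 1])
    (h02 : d ![f 0, f 2] = d' ![f 0, f 2]) (h12 : d ![f 1, f 2] = d' ![f 1, f 2]) : d = d' := by
  ext1 v
  have hv : v = ![v 0, v 1] := by ext i; fin_cases i <;> rfl
  rw [hv, L2.apply_eq d, L2.apply_eq d', h01, h02, h12]

theorem psi_apply (i j k : Fin 3) (x y : V A) :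
    psi i j k ![x, y] = (x i * y j - x j * y i) • (f k : V A) := rfl

theorem d2_apply (x y : V A) : (d2 : L2 A) ![x, y] = y 2 • x - x 2 • y := by
  funext k
  fin_cases k <;> simp [d2, psi_apply, f] <;> ring

theorem d2_apply_coords (x y : V A) : (d2 : L2 A) ![x, y] =
    ![x 0 * y 2 - x 2 * y 0, x 1 * y 2 - x 2 * y 1, 0] := by
  rw [d2_apply]
  funext k
  fin_cases k <;> simp <;> ring

theorem dDef_apply (t : Fin 3 → A) (x y : V A) :
    dDef t ![x, y] =
      ![(1 + t 0) * (x 0 * y 2 - x 2 * y 0) + t 2 * (x 1 * y 2 - x 2 * y 1),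
        t 1 * (x 0 * y 2 - x 2 * y 0) + (x 1 * y 2 - x 2 * y 1), 0] := by
  funext k
  fin_cases k <;>
    simp [dDef, d2, delta, psi_apply, f, Fin.sum_univ_three, AlternatingMap.add_apply,
      AlternatingMap.smul_apply] <;> ring

theorem dFam_apply (l m : ℂ) (x y : V ℂ) :
    dFam l m ![x, y] =
      ![l * (x 0 * y 2 - x 2 * y 0) + (x 1 * y 2 - x 2 * y 1),
        m * (x 1 * y 2 - x 2 * y 1), 0] := by
  funext k
  fin_cases k <;>
    simp [dFam, psi_apply, f, AlternatingMap.add_apply, AlternatingMap.smul_apply]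

theorem isCodifferential_dDef (t : Fin 3 → A) : IsCodifferential (dDef t) := by
  intro a b c
  funext k
  fin_cases k <;> simp [comp, dDef_apply] <;> ring

theorem push_apply_basis {B : Type v} [CommRing B] (h : A →+* B) (d : L2 A) {i j : Fin 3}
    (hij : i < j) (k : Fin 3) : push h d ![f i, f j] k = h (d ![f i, f j] k) := by
  fin_cases i <;> fin_cases j <;> simp at hij <;> fin_cases k <;>
    simp [push, Fin.sum_univ_three, psi_apply, f, AlternatingMap.add_apply,
      AlternatingMap.smul_apply]

theorem push_dDef {B : Type v} [CommRing B] (h : A →+* B) (t : Fin 3 → A) :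
    push h (dDef t) = dDef fun i => h (t i) := by
  apply L2.ext_basis <;> funext k <;> rw [push_apply_basis _ _ (by decide), dDef_apply,
    dDef_apply] <;> fin_cases k <;> simp [f]

theorem dDef_zero : (dDef 0 : L2 A) = d2 := by
  simp [dDef]

theorem pullback_eq_iff (g : V A ≃ₗ[A] V A) (d d' : L2 A) :
    pullback g d = d' ↔ ∀ x y, d ![g x, g y] = g (d' ![x, y]) := by
  have key : ∀ x y, pullback g d ![x, y] = g.symm (d ![g x, g y]) := fun x y => by
    have : (fun i => g (![x, y] i)) = ![g x, g y] := by ext1 i; fin_cases i <;> rfl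
    change g.symm (d fun i => g (![x, y] i)) = _
    rw [this]
  constructor
  · rintro rfl x y
    rw [key, g.apply_symm_apply]
  · intro h
    apply L2.ext_basis <;> rw [key, h, g.symm_apply_apply]

theorem exists_linearEquiv_mulVec (P : Matrix (Fin 3) (Fin 3) A) (hP : IsUnit P.det) :
    ∃ g : V A ≃ₗ[A] V A, ∀ x, g x = P.mulVec x :=
  ⟨Matrix.toLinearEquiv' P (P.invertibleOfIsUnitDet hP), fun _ => rfl⟩

end Coordinates

/-! ### The second cohomology group of `d₂` -/

theorem mem_Z2_d2_coords {ψ : L2 ℂ} (h : ψ ∈ Z2 d2) :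
    ψ ![f 0, f 1] 0 = -ψ ![f 1, f 2] 2 ∧ ψ ![f 0, f 1] 1 = ψ ![f 0, f 2] 2 ∧
      ψ ![f 0, f 1] 2 = 0 := by
  have h := h (f 0) (f 1) (f 2)
  simp only [comp, d2_apply] at h
  rw [L2.apply_eq ψ (_ - _) (f 2), L2.apply_eq ψ (_ - _) (f 1), L2.apply_eq ψ (_ - _) (f 0)] at h
  have h0 := congrFun h 0
  have h1 := congrFun h 1
  have h2 := congrFun h 2
  simp [f] at h0 h1 h2
  refine ⟨by simp only [f]; linear_combination -h0, by simp only [f]; linear_combination -h1, ?_⟩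
  simpa only [f] using h2

theorem delta_mem_Z2 (i : Fin 3) : delta i ∈ Z2 d2 := by
  intro a b c
  funext k
  fin_cases i <;> fin_cases k <;> simp [comp, delta, d2_apply, psi_apply, f] <;> ring

theorem sum_delta_mem_B2 {c : Fin 3 → ℂ} (h : ∑ i, c i • (delta i : L2 ℂ) ∈ B2 d2) : c = 0 := by
  obtain ⟨φ, hφ⟩ := h
  have h02 := hφ (f 0) (f 2)
  have h12 := hφ (f 1) (f 2)
  have a0 := congrFun h02 0
  have a1 := congrFun h02 1
  have b0 := congrFun h12 0
  have b1 := congrFun h12 1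
  simp [d2_apply, Fin.sum_univ_three, delta, psi_apply, f, AlternatingMap.add_apply,
    AlternatingMap.smul_apply] at a0 a1 b0 b1
  funext i
  fin_cases i <;> simp_all

theorem sub_sum_delta_mem_B2 {ψ : L2 ℂ} (h : ψ ∈ Z2 d2) :
    ψ - ∑ i, (![ψ ![f 0, f 2] 0 - ψ ![f 1, f 2] 1, ψ ![f 0, f 2] 1, ψ ![f 1, f 2] 0] i) •
      (delta i : L2 ℂ) ∈ B2 d2 := by
  obtain ⟨e0, e1, e2⟩ := mem_Z2_d2_coords h
  -- `D φ (a, b) = φ(b)₂ a - φ(a)₂ b`, so only the last row of `φ` matters.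
  obtain ⟨φ, hφ⟩ : ∃ φ : V ℂ →ₗ[ℂ] V ℂ, ∀ x, φ x = ![0, 0,
      -ψ ![f 0, f 2] 2 * x 0 - ψ ![f 1, f 2] 2 * x 1 + ψ ![f 1, f 2] 1 * x 2] := by
    refine ⟨Matrix.toLin' !![0, 0, 0; 0, 0, 0;
      -ψ ![f 0, f 2] 2, -ψ ![f 1, f 2] 2, ψ ![f 1, f 2] 1], fun x => ?_⟩
    funext k
    fin_cases k <;> simp [Matrix.mulVec, dotProduct, Fin.sum_univ_three]
    ring
  refine ⟨φ, fun a b => ?_⟩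
  rw [AlternatingMap.sub_apply, L2.apply_eq ψ]
  funext k
  fin_cases k <;>
    simp [d2_apply_coords, Fin.sum_univ_three, delta, psi_apply, AlternatingMap.add_apply,
      AlternatingMap.smul_apply, hφ, e0, e1, e2] <;>
    simp [f] <;> ring

theorem isPrebasisH2_delta : IsPrebasisH2 d2 delta := by
  refine ⟨delta_mem_Z2, ?_⟩
  let w : Fin 3 → H2 d2 := fun i =>
    ⟨(B2 d2).mkQ (delta i), Submodule.mem_map_of_mem (delta_mem_Z2 i)⟩
  have hsum : ∀ c : Fin 3 → ℂ, ((∑ i, c i • w i : H2 d2) : L2 ℂ ⧸ B2 d2) =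
      (B2 d2).mkQ (∑ i, c i • delta i) := fun c => by simp [w]
  have hli : LinearIndependent ℂ w := by
    rw [Fintype.linearIndependent_iff]
    intro c hc
    have h := hsum c
    rw [hc] at h
    exact congrFun (sum_delta_mem_B2 ((Submodule.Quotient.mk_eq_zero _).1 h.symm))
  have hsp : ⊤ ≤ Submodule.span ℂ (Set.range w) := by
    rintro ⟨z, ψ, hψ, rfl⟩ -
    rw [Submodule.mem_span_range_iff_exists_fun]
    exact ⟨_, Subtype.ext ((hsum _).trans
      ((Submodule.Quotient.eq _).2 (sub_sum_delta_mem_B2 hψ)).symm)⟩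
  exact ⟨Module.Basis.mk hli hsp, fun i => by rw [Module.Basis.mk_apply]⟩

/-! ### Complex fibres of the family -/

theorem exists_pullback_dDef_diag {s : ℂ} (hs : s ≠ 0) : ∃ g : V ℂ ≃ₗ[ℂ] V ℂ,
    (∀ x, g x = ![s * x 0, x 1, x 2]) ∧ pullback g (dDef ![0, 0, s]) = dFam 1 1 := by
  obtain ⟨g, hg⟩ := exists_linearEquiv_mulVec (!![s, 0, 0; 0, 1, 0; 0, 0, 1])
    (by simpa [Matrix.det_fin_three] using hs)
  have hg' : ∀ x, g x = ![s * x 0, x 1, x 2] := fun x => by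
    rw [hg]
    funext k
    fin_cases k <;> simp [Matrix.mulVec, dotProduct, Fin.sum_univ_three]
  refine ⟨g, hg', (pullback_eq_iff _ _ _).2 fun x y => ?_⟩
  simp only [hg', dDef_apply, dFam_apply]
  funext k
  fin_cases k <;> simp
  ring

/-- In `d₂` every bracket `[x, y]` lies in the span of `x` and `y`, and this is preserved by
isomorphisms; in `d(1:1)` the bracket of `f 1` and `f 2` has a nonzero coefficient at `f 0`. -/
theorem not_equivalent_d2_dFam : ¬ Equivalent (d2 : L2 ℂ) (dFam 1 1) := by
  rintro ⟨g, hg⟩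
  have h := (pullback_eq_iff _ _ _).1 hg (f 1) (f 2)
  rw [d2_apply, ← map_smul, ← map_smul, ← map_sub] at h
  have h0 := congrFun (g.injective h) 0
  simp [dFam_apply, f] at h0

theorem isJumpDeformation_dDef :
    IsJumpDeformation (fun s => dDef ![0, 0, s]) d2 (dFam 1 1) where
  codifferential s := isCodifferential_dDef _
  analytic x i := by
    have hx : x = ![x 0, x 1] := by ext i; fin_cases i <;> rfl
    rw [hx]
    simp only [dDef_apply]
    fin_cases i <;> simp <;> fun_prop
  zero := by
    rw [← dDef_zero]
    congr 1
    funext i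
    fin_cases i <;> rfl
  equivalent := by
    filter_upwards [self_mem_nhdsWithin] with s hs
    obtain ⟨g, -, hg⟩ := exists_pullback_dDef_diag hs
    exact ⟨g, hg⟩
  not_equivalent := not_equivalent_d2_dFam

/-- `dDef t` is the semidirect product given by the matrix `M = (1 + t 0, t 2; t 1, 1)`. When `M` is
not scalar, some `w` is not an eigenvector of `M`, and in the basis `(M - β) w, w` the matrix takes
the form `(α, 1; 0, β)`. -/
theorem equivalent_dDef_dFam {t : Fin 3 → ℂ} {α β : ℂ} (ht : ¬ (t 0 = 0 ∧ t 1 = 0 ∧ t 2 = 0))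
    (hsum : α + β = 2 + t 0) (hprod : α * β = 1 + t 0 - t 1 * t 2) :
    Equivalent (dDef t) (dFam α β) := by
  -- The left-hand side is the determinant of `(M - β) w` and `w`, a quadratic form in `w`.
  obtain ⟨w0, w1, hw⟩ : ∃ w0 w1 : ℂ, t 0 * w0 * w1 + t 2 * w1 ^ 2 - t 1 * w0 ^ 2 ≠ 0 := by
    by_cases h1 : t 1 = 0
    · by_cases h2 : t 2 = 0
      · exact ⟨1, 1, by simp_all⟩
      · exact ⟨0, 1, by simpa using h2⟩
    · exact ⟨1, 0, by simpa using h1⟩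
  obtain ⟨g, hg⟩ := exists_linearEquiv_mulVec
    (!![(1 + t 0 - β) * w0 + t 2 * w1, w0, 0; t 1 * w0 + (1 - β) * w1, w1, 0; 0, 0, 1]) (by
      rw [isUnit_iff_ne_zero]
      convert hw using 1
      simp [Matrix.det_fin_three]
      ring)
  refine ⟨g, (pullback_eq_iff _ _ _).2 fun x y => ?_⟩
  simp only [hg, dDef_apply, dFam_apply]
  obtain rfl : α = 2 + t 0 - β := by linear_combination hsum
  funext k
  fin_cases k <;> simp [Matrix.mulVec, dotProduct, Fin.sum_univ_three]
  · linear_combination (x 0 * y 2 - x 2 * y 0) * w0 * hprod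
  · linear_combination (x 0 * y 2 - x 2 * y 0) * w1 * hprod

/-! ### Augmented local algebras -/

section Augmented

variable {B : Type u} [CommRing B] [Algebra ℂ B] (ε : B →ₐ[ℂ] ℂ)

theorem augmentation_surjective : Function.Surjective ε := fun c =>
  ⟨algebraMap ℂ B c, ε.commutes c⟩

theorem isUnit_of_augmentation_ne_zero (hB : IsLocalRing B) {x : B} (hx : ε x ≠ 0) :
    IsUnit x := by
  by_contra h
  have hm : RingHom.ker ε = IsLocalRing.maximalIdeal B :=
    IsLocalRing.eq_maximalIdeal (RingHom.ker_isMaximal_of_surjective ε (augmentation_surjective ε))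
  have : x ∈ RingHom.ker ε := hm ▸ (IsLocalRing.mem_maximalIdeal x).2 h
  exact hx this

theorem sub_algebraMap_mem_ker (x : B) : x - algebraMap ℂ B (ε x) ∈ RingHom.ker ε := by
  simp [RingHom.mem_ker]

theorem mul_eq_zero_of_ker_sq_eq_bot {ε : B →ₐ[ℂ] ℂ} (h : RingHom.ker ε ^ 2 = ⊥) {x y : B}
    (hx : ε x = 0) (hy : ε y = 0) : x * y = 0 := by
  have : x * y ∈ RingHom.ker ε ^ 2 := by
    rw [sq]
    exact Ideal.mul_mem_mul hx hy
  rwa [h, Ideal.mem_bot] at this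

theorem isLocalRing_of_ker_sq_eq_bot (h : RingHom.ker ε ^ 2 = ⊥) : IsLocalRing B := by
  have : Nontrivial B := ε.toRingHom.domain_nontrivial
  have unit : ∀ x, ε x ≠ 0 → IsUnit x := fun x hx => by
    have hn : IsNilpotent (x - algebraMap ℂ B (ε x)) :=
      ⟨2, by
        rw [sq]
        exact mul_eq_zero_of_ker_sq_eq_bot h (sub_algebraMap_mem_ker ε x)
          (sub_algebraMap_mem_ker ε x)⟩
    have hu : IsUnit (algebraMap ℂ B (ε x)) := (isUnit_iff_ne_zero.2 hx).map (algebraMap ℂ B)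
    simpa using hn.isUnit_add_right_of_commute hu (Commute.all _ _)
  refine IsLocalRing.of_isUnit_or_isUnit_one_sub_self fun x => ?_
  by_cases hx : ε x = 0
  · exact Or.inr (unit _ (by simp [hx]))
  · exact Or.inl (unit _ hx)

theorem IsInfinitesimalAlgebra.of_ker_sq_eq_bot (h : RingHom.ker ε ^ 2 = ⊥) :
    IsInfinitesimalAlgebra ε :=
  ⟨isLocalRing_of_ker_sq_eq_bot ε h, h⟩

/-- A homomorphism from a local augmented algebra commutes with the augmentations: otherwise some
`x - c` with `c = ε_B (h x) ≠ 0 = ε x` would be a unit with non-unit image. -/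
theorem augmentation_comp {A : Type v} [CommRing A] [Algebra ℂ A] {ε' : A →ₐ[ℂ] ℂ}
    (hA : IsLocalRing A) (h : A →ₐ[ℂ] B) (x : A) : ε (h x) = ε' x := by
  by_contra hne
  have hu : IsUnit (x - algebraMap ℂ A (ε (h x))) :=
    isUnit_of_augmentation_ne_zero ε' hA (by
      simpa [sub_eq_zero] using fun e => hne (Eq.symm e))
  have := (hu.map h).map ε
  simp at this

end Augmented

/-! ### The two bases -/

theorem ker_augPS : RingHom.ker augPS = Ideal.span (Set.range (MvPowerSeries.X : Fin 3 → PS)) := by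
  apply le_antisymm
  · intro p hp
    have hp0 : MvPowerSeries.coeff 0 p = 0 := hp
    -- Group the monomials of `p` by the first variable that they contain.
    let a : PS := fun m => if m 0 ≠ 0 then MvPowerSeries.coeff m p else 0
    let b : PS := fun m => if m 0 = 0 ∧ m 1 ≠ 0 then MvPowerSeries.coeff m p else 0
    let c : PS := fun m => if m 0 = 0 ∧ m 1 = 0 ∧ m 2 ≠ 0 then MvPowerSeries.coeff m p else 0
    have ha : ∀ m, MvPowerSeries.coeff m a = if m 0 ≠ 0 then MvPowerSeries.coeff m p else 0 :=
      fun _ => rfl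
    have hb : ∀ m, MvPowerSeries.coeff m b =
        if m 0 = 0 ∧ m 1 ≠ 0 then MvPowerSeries.coeff m p else 0 := fun _ => rfl
    have hc : ∀ m, MvPowerSeries.coeff m c =
        if m 0 = 0 ∧ m 1 = 0 ∧ m 2 ≠ 0 then MvPowerSeries.coeff m p else 0 := fun _ => rfl
    have hp' : p = a + b + c := by
      ext m
      simp only [map_add, ha, hb, hc]
      by_cases h0 : m 0 = 0 <;> by_cases h1 : m 1 = 0 <;> by_cases h2 : m 2 = 0 <;>
        simp [h0, h1, h2]
      have : m = 0 := by
        ext i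
        fin_cases i <;> assumption
      rw [this, hp0]
    have mem : ∀ (i : Fin 3) (q : PS), MvPowerSeries.X i ∣ q →
        q ∈ Ideal.span (Set.range (MvPowerSeries.X : Fin 3 → PS)) := fun i q hq =>
      Ideal.mem_of_dvd _ hq (Ideal.subset_span ⟨i, rfl⟩)
    rw [hp']
    refine Ideal.add_mem _ (Ideal.add_mem _ (mem 0 _ ?_) (mem 1 _ ?_)) (mem 2 _ ?_) <;>
      rw [MvPowerSeries.X_dvd_iff] <;> intro m hm
    · simp [ha, hm]
    · simp [hb, hm]
    · simp [hc, hm]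
  · rw [Ideal.span_le]
    rintro _ ⟨i, rfl⟩
    exact MvPowerSeries.constantCoeff_X i

theorem augPS_X (i : Fin 3) : augPS (MvPowerSeries.X i) = 0 :=
  MvPowerSeries.constantCoeff_X i

theorem isFormalAlgebra_augPS : IsFormalAlgebra augPS where
  isLocal := inferInstance
  complete := by
    rw [ker_augPS]
    infer_instance

theorem augInf1_mk (p : MvPolynomial (Fin 3) ℂ) :
    augInf1 (Ideal.Quotient.mk _ p) = MvPolynomial.aeval (0 : Fin 3 → ℂ) p := rfl

theorem ker_augInf1_sq : RingHom.ker augInf1 ^ 2 = ⊥ := by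
  have hle : RingHom.ker augInf1 ≤ (MvPolynomial.idealOfVars (Fin 3) ℂ).map
      (Ideal.Quotient.mk (MvPolynomial.idealOfVars (Fin 3) ℂ ^ 2)) := by
    intro x hx
    obtain ⟨p, rfl⟩ := Ideal.Quotient.mk_surjective x
    refine Ideal.mem_map_of_mem _ ?_
    have hp : MvPolynomial.aeval (0 : Fin 3 → ℂ) p = 0 := hx
    rw [← pow_one (MvPolynomial.idealOfVars (Fin 3) ℂ), MvPolynomial.mem_pow_idealOfVars_iff']
    intro m hm
    obtain rfl : m = 0 := by simpa [Finsupp.degree_eq_zero_iff] using hm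
    simpa [MvPolynomial.constantCoeff_eq] using hp
  refine le_bot_iff.1 ((Ideal.pow_right_mono hle 2).trans ?_)
  rw [← Ideal.map_pow, Ideal.map_quotient_self]

theorem isInfinitesimalAlgebra_augInf1 : IsInfinitesimalAlgebra augInf1 :=
  .of_ker_sq_eq_bot _ ker_augInf1_sq

section Hom

variable {B : Type u} [CommRing B] [Algebra ℂ B] {ε : B →ₐ[ℂ] ℂ}

theorem map_idealOfVars_pow_le {t : Fin 3 → B} (ht : ∀ i, ε (t i) = 0) (n : ℕ) :
    (MvPolynomial.idealOfVars (Fin 3) ℂ ^ n).map (MvPolynomial.aeval t) ≤ RingHom.ker ε ^ n := by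
  rw [Ideal.map_pow]
  refine Ideal.pow_right_mono ?_ n
  rw [Ideal.map_span, Ideal.span_le]
  rintro _ ⟨_, ⟨i, rfl⟩, rfl⟩
  simpa [RingHom.mem_ker] using ht i

theorem exists_algHom_Inf1 (hB : IsInfinitesimalAlgebra ε) {t : Fin 3 → B}
    (ht : ∀ i, ε (t i) = 0) :
    ∃ h : Inf1 →ₐ[ℂ] B, ∀ i, h (Ideal.Quotient.mk _ (MvPolynomial.X i)) = t i := by
  refine ⟨Ideal.Quotient.liftₐ _ (MvPolynomial.aeval t) fun a ha => ?_, fun i => ?_⟩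
  · have := map_idealOfVars_pow_le ht 2 (Ideal.mem_map_of_mem _ ha)
    rwa [hB.sq_eq_bot] at this
  · exact MvPolynomial.aeval_X t i

theorem algHom_Inf1_ext {h h' : Inf1 →ₐ[ℂ] B}
    (H : ∀ i, h (Ideal.Quotient.mk _ (MvPolynomial.X i)) =
      h' (Ideal.Quotient.mk _ (MvPolynomial.X i))) : h = h' :=
  Ideal.Quotient.algHom_ext _ (MvPolynomial.algHom_ext H)

/-- Substitution of elements of the maximal ideal into power series, as the limit of substitution
into truncations modulo the powers of the maximal ideal. -/
theorem exists_algHom_PS (hB : IsFormalAlgebra ε) {t : Fin 3 → B} (ht : ∀ i, ε (t i) = 0) :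
    ∃ h : PS →ₐ[ℂ] B, ∀ i, h (MvPowerSeries.X i) = t i := by
  have := hB.complete
  let J := MvPolynomial.idealOfVars (Fin 3) ℂ
  let q (n : ℕ) : (MvPolynomial (Fin 3) ℂ ⧸ J ^ n) →ₐ[ℂ] B ⧸ RingHom.ker ε ^ n :=
    Ideal.Quotient.liftₐ _ ((Ideal.Quotient.mkₐ ℂ _).comp (MvPolynomial.aeval t)) fun a ha =>
      Ideal.Quotient.eq_zero_iff_mem.2 (map_idealOfVars_pow_le ht n (Ideal.mem_map_of_mem _ ha))
  have hq : ∀ n p, q n (Ideal.Quotient.mk _ p) = Ideal.Quotient.mk _ (MvPolynomial.aeval t p) :=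
    fun _ _ => rfl
  let F (n : ℕ) : PS →ₐ[ℂ] B ⧸ RingHom.ker ε ^ n :=
    (q n).comp ((MvPowerSeries.truncTotalAlgHom (Fin 3) ℂ n).restrictScalars ℂ)
  have compat : ∀ {m n : ℕ} (hle : m ≤ n),
      (Ideal.Quotient.factorₐ ℂ (Ideal.pow_le_pow_right hle)).comp (F n) = F m := fun {m n} hle => by
    ext p
    change Ideal.Quotient.mk _ (MvPolynomial.aeval t (MvPowerSeries.truncTotal n p)) =
      Ideal.Quotient.mk _ (MvPolynomial.aeval t (MvPowerSeries.truncTotal m p))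
    rw [Ideal.Quotient.eq, ← map_sub]
    exact map_idealOfVars_pow_le ht m (Ideal.mem_map_of_mem _
      (MvPowerSeries.truncTotal_sub_truncTotal_mem_pow_idealOfVars hle le_rfl p))
  refine ⟨IsAdicComplete.liftAlgHom (RingHom.ker ε) F compat, fun i => ?_⟩
  refine (IsHausdorff.eq_iff_smodEq (I := RingHom.ker ε)).2 fun n => ?_
  have h1 : MvPowerSeries.truncTotalAlgHom (Fin 3) ℂ n (MvPowerSeries.X i) =
      Ideal.Quotient.mk _ (MvPolynomial.X i) := by
    rw [← MvPolynomial.coe_X]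
    exact (MvPowerSeries.truncTotalAlgHom (Fin 3) ℂ n).commutes (MvPolynomial.X i)
  have h2 := IsAdicComplete.mk_liftAlgHom (RingHom.ker ε) F compat n (MvPowerSeries.X i)
  have h3 : F n (MvPowerSeries.X i) = Ideal.Quotient.mk _ (t i) := by
    change q n (MvPowerSeries.truncTotalAlgHom (Fin 3) ℂ n (MvPowerSeries.X i)) = _
    rw [h1, hq, MvPolynomial.aeval_X]
  rw [h3] at h2
  rw [SModEq.sub_mem, smul_eq_mul, Ideal.mul_top]
  exact Ideal.Quotient.eq.1 h2

/-- Power series in the maximal ideal are combinations of the variables, and into an infinitesimal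
base only the constant terms of the coefficients matter, so homomorphisms are determined by the
images of the variables without any continuity hypothesis. -/
theorem algHom_PS_ext (hB : IsInfinitesimalAlgebra ε) {h h' : PS →ₐ[ℂ] B}
    (H : ∀ i, h (MvPowerSeries.X i) = h' (MvPowerSeries.X i)) : h = h' := by
  have aug : ∀ (k : PS →ₐ[ℂ] B) (p : PS), ε (k p) = augPS p :=
    augmentation_comp ε isFormalAlgebra_augPS.isLocal
  have key : ∀ (k : PS →ₐ[ℂ] B) (p : PS) (i : Fin 3),
      k (p * MvPowerSeries.X i) = algebraMap ℂ B (augPS p) * k (MvPowerSeries.X i) := fun k p i => by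
    have h0 := mul_eq_zero_of_ker_sq_eq_bot hB.sq_eq_bot
      (sub_algebraMap_mem_ker ε (k p)) (show ε (k (MvPowerSeries.X i)) = 0 by rw [aug, augPS_X])
    rw [aug] at h0
    rw [map_mul]
    linear_combination h0
  have hker : ∀ p ∈ RingHom.ker augPS, h p = h' p := by
    intro p hp
    rw [ker_augPS] at hp
    obtain ⟨c, rfl⟩ := (Submodule.mem_span_range_iff_exists_fun _).1 hp
    simp only [smul_eq_mul, map_sum, key, H]
  ext p
  have := hker _ (sub_algebraMap_mem_ker augPS p)
  simpa using this

end Hom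

/-! ### Normal form of deformations of `d₂` -/

/-- With `a, b, c` the brackets of the basis vectors and `θ x = tr (ad x)`, the Jacobi identity
is `θ (f 0) c - θ (f 1) b + θ (f 2) a = 0`. -/
theorem IsCodifferential.jacobi_basis {A : Type u} [CommRing A] {d : L2 A} (hd : IsCodifferential d) :
    (d ![f 0, f 1] 0 - d ![f 1, f 2] 2) • d ![f 0, f 2]
      + (d ![f 0, f 1] 1 + d ![f 0, f 2] 2) • d ![f 1, f 2]
      = (d ![f 0, f 2] 0 + d ![f 1, f 2] 1) • d ![f 0, f 1] := by
  have h := hd (f 0) (f 1) (f 2)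
  rw [comp, L2.apply_eq d (d ![f 0, f 1]) (f 2), L2.apply_eq d (d ![f 0, f 2]) (f 1),
    L2.apply_eq d (d ![f 1, f 2]) (f 0)] at h
  rw [← sub_eq_zero, ← h]
  funext k
  simp [f]
  ring

section Deformation

variable {B : Type u} [CommRing B] [Algebra ℂ B] {ε : B →ₐ[ℂ] ℂ}

theorem IsDeformation.augmentation_coeff {d : L2 ℂ} {dB : L2 B} (hd : IsDeformation ε d dB)
    {i j : Fin 3} (hij : i < j) (k : Fin 3) : ε (dB ![f i, f j] k) = d ![f i, f j] k := by
  rw [← hd.augmentation, push_apply_basis _ _ hij]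
  rfl

theorem isDeformation_dDef {t : Fin 3 → B} (ht : ∀ i, ε (t i) = 0) :
    IsDeformation ε d2 (dDef t) where
  codifferential := isCodifferential_dDef t
  augmentation := by
    rw [push_dDef, ← dDef_zero]
    congr 1
    funext i
    exact ht i

/-- The normal form: every deformation of `d₂` over a local base is infinitesimally equivalent to a
member of the family. Its brackets lie in the kernel of `x ↦ tr (ad x)`, which is an abelian ideal
of rank two; the equivalence takes a multiple of this functional as its third coordinate. -/
theorem exists_infEquivalent_dDef (hB : IsLocalRing B) {dB : L2 B} (hd : IsDeformation ε d2 dB) :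
    ∃ t : Fin 3 → B, (∀ i, ε (t i) = 0) ∧ InfEquivalent ε (dDef t) dB := by
  have J := hd.codifferential.jacobi_basis
  have e01 := hd.augmentation_coeff (i := 0) (j := 1) (by decide)
  have e02 := hd.augmentation_coeff (i := 0) (j := 2) (by decide)
  have e12 := hd.augmentation_coeff (i := 1) (j := 2) (by decide)
  have expand := L2.apply_eq dB
  generalize dB ![f 0, f 1] = a at *
  generalize dB ![f 0, f 2] = b at *
  generalize dB ![f 1, f 2] = c at *
  simp only [d2_apply_coords] at e01 e02 e12
  have a0 := e01 0
  have a1 := e01 1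
  have b0 := e02 0
  have b1 := e02 1
  have b2 := e02 2
  have c0 := e12 0
  have c1 := e12 1
  have c2 := e12 2
  simp [f] at a0 a1 b0 b1 b2 c0 c1 c2
  have J0 := congrFun J 0
  have J1 := congrFun J 1
  have J2 := congrFun J 2
  simp only [Pi.add_apply, Pi.smul_apply, smul_eq_mul] at J0 J1 J2
  obtain ⟨u, hu⟩ := (isUnit_of_augmentation_ne_zero ε hB (x := c 1) (by simp [c1])).exists_right_inv
  obtain ⟨s, hs⟩ := (isUnit_of_augmentation_ne_zero ε hB (x := b 0 + c 1)
    (by simp [b0, c1])).exists_right_inv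
  have εu : ε u = 1 := by simpa [c1] using congrArg ε hu
  -- The third row is `-(c 1) / (b 0 + c 1)` times the trace form, so that its last entry is `c 1`,
  -- whose inverse is `u`; `s` is the inverse of `b 0 + c 1`.
  obtain ⟨g, hg⟩ := exists_linearEquiv_mulVec (!![1, 0, 0; 0, 1, 0;
    -(c 1 * s * (a 1 + b 2)), c 1 * s * (a 0 - c 2), c 1]) (by
      simpa [Matrix.det_fin_three] using IsUnit.of_mul_eq_one _ hu)
  refine ⟨![b 0 * u - 1, b 1 * u, c 0 * u], fun i => ?_, g, fun x i => ?_,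
    (pullback_eq_iff _ _ _).2 fun x y => ?_⟩
  · fin_cases i <;> simp [b0, b1, c0, εu]
  · rw [hg]
    fin_cases i <;> simp [Matrix.mulVec, dotProduct, Fin.sum_univ_three, a0, a1, b2, c1, c2]
  · rw [dDef_apply, expand, hg, hg, hg]
    funext k
    fin_cases k <;> simp [Matrix.mulVec, dotProduct, Fin.sum_univ_three]
    · linear_combination (b 0 * (x 0 * y 2 - x 2 * y 0) + c 0 * (x 1 * y 2 - x 2 * y 1)
          + a 0 * (x 0 * y 1 - x 1 * y 0)) * hu
        + (x 0 * y 1 - x 1 * y 0) * u * c 1 * (s * J0 + a 0 * hs)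
    · linear_combination b 1 * (x 0 * y 2 - x 2 * y 0) * hu
        + (x 0 * y 1 - x 1 * y 0) * (b 1 * s * (a 0 - c 2) * hu + s * J1 + a 1 * hs)
    · linear_combination (x 0 * y 1 - x 1 * y 0) * c 1 * (s * J2 + a 2 * hs)
        - (x 0 * y 2 - x 2 * y 0) * c 1 * (s * J1 - b 2 * hs)
        + (x 1 * y 2 - x 2 * y 1) * c 1 * (s * J0 + c 2 * hs)

/-- Over an infinitesimal base the parameters of an equivalent member of the family can be read off
from the structure constants of a deformation. -/
theorem parameters_of_infEquivalent (hsq : RingHom.ker ε ^ 2 = ⊥) {dB : L2 B}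
    (hd : IsDeformation ε d2 dB) {t : Fin 3 → B} (ht : ∀ i, ε (t i) = 0)
    (h : InfEquivalent ε (dDef t) dB) :
    t = ![dB ![f 0, f 2] 0 - dB ![f 1, f 2] 1, dB ![f 0, f 2] 1, dB ![f 1, f 2] 0] := by
  have e02 := hd.augmentation_coeff (i := 0) (j := 2) (by decide)
  have e12 := hd.augmentation_coeff (i := 1) (j := 2) (by decide)
  obtain ⟨g, hε, hg⟩ := h
  rw [pullback_eq_iff] at hg
  have hg02 := hg (f 0) (f 2)
  have hg12 := hg (f 1) (f 2)
  generalize dB ![f 0, f 2] = b at *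
  generalize dB ![f 1, f 2] = c at *
  have expand : ∀ x : V B, g x = x 0 • g (f 0) + x 1 • g (f 1) + x 2 • g (f 2) := fun x => by
    rw [← map_smul, ← map_smul, ← map_smul, ← map_add, ← map_add]
    congr 1
    funext i
    fin_cases i <;> simp [f]
  rw [expand b, dDef_apply] at hg02
  rw [expand c, dDef_apply] at hg12
  have p0 := fun i => hε (f 0) i
  have p1 := fun i => hε (f 1) i
  have p2 := fun i => hε (f 2) i
  generalize g (f 0) = x at *
  generalize g (f 1) = y at *
  generalize g (f 2) = z at *
  simp only [d2_apply_coords] at e02 e12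
  have mul : ∀ {x y : B}, ε x = 0 → ε y = 0 → x * y = 0 := mul_eq_zero_of_ker_sq_eq_bot hsq
  have t0 := ht 0
  have t1 := ht 1
  have t2 := ht 2
  have x0 : ε (x 0 - 1) = 0 := by simp [p0, f]
  have x1 : ε (x 1) = 0 := by simp [p0, f]
  have x2 : ε (x 2) = 0 := by simp [p0, f]
  have y0 : ε (y 0) = 0 := by simp [p1, f]
  have y1 : ε (y 1 - 1) = 0 := by simp [p1, f]
  have y2 : ε (y 2) = 0 := by simp [p1, f]
  have z0 : ε (z 0) = 0 := by simp [p2, f]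
  have z1 : ε (z 1) = 0 := by simp [p2, f]
  have z2 : ε (z 2 - 1) = 0 := by simp [p2, f]
  have b0 : ε (b 0 - 1) = 0 := by simp [e02, f]
  have b1 : ε (b 1) = 0 := by simp [e02, f]
  have b2 : ε (b 2) = 0 := by simp [e02, f]
  have c0 : ε (c 0) = 0 := by simp [e12, f]
  have c1 : ε (c 1 - 1) = 0 := by simp [e12, f]
  have c2 : ε (c 2) = 0 := by simp [e12, f]
  have B0 := congrFun hg02 0
  have B1 := congrFun hg02 1
  have C0 := congrFun hg12 0
  have C1 := congrFun hg12 1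
  simp at B0 B1 C0 C1
  -- The linear parts of the four equations, in which all products of small terms vanish.
  have lin0 : t 0 + z 2 - b 0 = 0 := by
    linear_combination B0 - (1 + t 0) * mul x0 z2 - mul t0 x0 - mul t0 z2 + (1 + t 0) * mul x2 z0
      - z 2 * mul t2 x1 + z 1 * mul t2 x2 + mul b0 x0 + mul b1 y0 + mul b2 z0
  have lin1 : t 1 - b 1 = 0 := by
    linear_combination B1 - z 2 * mul t1 x0 - mul t1 z2 + z 0 * mul t1 x2 - mul x1 z2 + mul x2 z1
      + mul b0 x1 + mul b1 y1 + mul b2 z1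
  have lin2 : t 2 - c 0 = 0 := by
    linear_combination C0 - mul y0 z2 - z 2 * mul t0 y0 + (1 + t 0) * mul y2 z0 - mul t2 z2
      - z 2 * mul t2 y1 + z 1 * mul t2 y2 + mul c0 x0 + mul c1 y0 + mul c2 z0
  have lin3 : z 2 - c 1 = 0 := by
    linear_combination C1 - z 2 * mul t1 y0 + z 0 * mul t1 y2 - mul y1 z2 + mul y2 z1
      + mul c0 x1 + mul c1 y1 + mul c2 z1
  funext i
  fin_cases i
  · change t 0 = b 0 - c 1
    linear_combination lin0 - lin3
  · exact sub_eq_zero.1 lin1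
  · exact sub_eq_zero.1 lin2

end Deformation

end LieDef

open LieDef
theorem mainTheorem5 :
    -- the cochains `δ₁, δ₂, δ₃` are a prebasis of `H²(d₂)`, and `d₂ + δ_i t^i` is a universal
    -- infinitesimal deformation over `ℂ[t¹, t², t³] / (t¹, t², t³)²`
    IsPrebasisH2 d2 delta ∧
    IsUniversalInfinitesimal.{0, u} augInf1 d2
      (dDef fun i => (Ideal.Quotient.mk _ (MvPolynomial.X i) : Inf1)) ∧
    -- the same formula over `ℂ[[t¹, t², t³]]` is a miniversal deformation
    IsMiniversal.{0, u} augPS d2 (dDef fun i => (MvPowerSeries.X i : PS)) ∧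
    -- the curve `t¹ = t² = 0` is a jump deformation to `d(1:1)`
    (∀ s : ℂ, s ≠ 0 → ∃ g : V ℂ ≃ₗ[ℂ] V ℂ,
      (∀ x, g x = ![s * x 0, x 1, x 2]) ∧ pullback g (dDef ![0, 0, s]) = dFam 1 1) ∧
    IsJumpDeformation (fun s => dDef ![0, 0, s]) d2 (dFam 1 1) ∧
    -- otherwise the structure is `d(α:β)`
    (∀ (t : Fin 3 → ℂ) (r α β : ℂ), ¬ (t 0 = 0 ∧ t 1 = 0) →
      r ^ 2 = t 0 ^ 2 + 4 * t 1 * t 2 →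
      α = (2 + t 0 + r) / 2 → β = (2 + t 0 - r) / 2 → ¬ (α = 0 ∧ β = 0) →
      Equivalent (dDef t) (dFam α β)) := by
  have hX : ∀ i, augInf1 (Ideal.Quotient.mk _ (MvPolynomial.X i)) = 0 := fun i => by
    rw [augInf1_mk, MvPolynomial.aeval_X]
    rfl
  refine ⟨isPrebasisH2_delta, ⟨isInfinitesimalAlgebra_augInf1, isDeformation_dDef hX, ?_⟩,
    ⟨⟨isFormalAlgebra_augPS, isDeformation_dDef augPS_X, ?_⟩, ?_⟩,
    fun s hs => exists_pullback_dDef_diag hs, isJumpDeformation_dDef, ?_⟩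
  · intro B _ _ ε dB hB hd
    obtain ⟨t, ht, hE⟩ := exists_infEquivalent_dDef hB.isLocal hd
    obtain ⟨h, hh⟩ := exists_algHom_Inf1 hB ht
    refine ⟨h, ?_, fun h' hE' => algHom_Inf1_ext fun i => ?_⟩
    · simpa only [push_dDef, RingHom.coe_coe, hh] using hE
    · have ht' : ∀ i, ε (h' (Ideal.Quotient.mk _ (MvPolynomial.X i))) = 0 := fun i => by
        rw [augmentation_comp ε isInfinitesimalAlgebra_augInf1.isLocal, hX]
      simp only [push_dDef] at hE'
      rw [hh, parameters_of_infEquivalent hB.sq_eq_bot hd ht hE]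
      exact congrFun (parameters_of_infEquivalent hB.sq_eq_bot hd ht' hE') i
  · intro B _ _ ε dB hB hd
    obtain ⟨t, ht, hE⟩ := exists_infEquivalent_dDef hB.isLocal hd
    obtain ⟨h, hh⟩ := exists_algHom_PS hB ht
    refine ⟨h, ?_⟩
    simpa only [push_dDef, RingHom.coe_coe, hh] using hE
  · intro B _ _ ε dB hB hd h h' hE hE'
    have par : ∀ k : PS →ₐ[ℂ] B, InfEquivalent ε (push (k : PS →+* B)
        (dDef fun i => (MvPowerSeries.X i : PS))) dB → (fun i => k (MvPowerSeries.X i)) =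
        ![dB ![f 0, f 2] 0 - dB ![f 1, f 2] 1, dB ![f 0, f 2] 1, dB ![f 1, f 2] 0] :=
      fun k hk => parameters_of_infEquivalent hB.sq_eq_bot hd
        (fun i => by rw [augmentation_comp ε isFormalAlgebra_augPS.isLocal, augPS_X])
        (push_dDef (k : PS →+* B) _ ▸ hk)
    exact algHom_PS_ext hB (congrFun ((par h hE).trans (par h' hE').symm))
  · rintro t r α β ht hr rfl rfl -
    exact equivalent_dDef_dFam (fun h => ht ⟨h.1, h.2.1⟩) (by ring)
      (by linear_combination -(1 / 4) * hr)
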